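/- Let $\mathfrak A$ be a $C^*$-algebra, let $H$ and $K$ be Hilbert $\mathfrak A$-modules, and let $\mathcal L(H,K)$ denote the set of adjointable operators from $H$ to $K$, with $\mathcal L(H)=\mathcal L(H,H)$ and identity operators $I_H$, $I_K$. A weight on $K$ is a self-adjoint operator $M=M^*\in\mathcal L(K)$ that is invertible in $\mathcal L(K)$ (positivity is not required). For weights $M\in\mathcal L(K)$, $N\in\mathcal L(H)$ and $A\in\mathcal L(H,K)$, the weighted Moore–Penrose inverse $A^\dagger_{MN}$, if it exists, is the (necessarily unique) $X\in\mathcal L(K,H)$ with $$AXA=A,\quad XAX=X,\quad (MAX)^*=MAX,\quad (NXA)^*=NXA;$$ write $A^\dagger=A^\dagger_{I_KI_H}$. When $A^\dagger$ exists, put $$R_{A,N}=A^\dagger A+(I_H-A^\dagger A)N,\qquad L_{A,M^{-1}}=AA^\dagger+M^{-1}(I_K-AA^\dagger).$$ Theorem. Let $M\in\mathcal L(K)$ and $N\in\mathcal L(H)$ be weights and let $A\in\mathcal L(H,K)$. The following statements are equivalent: (i) $A^\dagger_{MN}$ exists; (ii) $A^\dagger_{MI_H}$ and $A^\dagger_{I_KN}$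 both exist; (iii) $A^\dagger$ exists, and $R_{A,N}$ and $L_{A,M^{-1}}$ are invertible in $\mathcal L(H)$ and $\mathcal L(K)$ respectively. In each case, $$A^\dagger_{MN}=R_{A,N}^{-1}\,A^\dagger\,L_{A,M^{-1}}^{-1}.$$ -/

import Mathlib

/-!
Hilbert C⋆-modules are Mathlib's `CStarModule A E` (`A` a possibly non-unital C⋆-algebra) with `E`
complete. In Mathlib `A` acts through `•` and `inner A x (a • y) = a * inner A x y`. As `A` ranges
over all C⋆-algebras this covers right Hilbert modules: a right Hilbert module over a C⋆-algebra
is the same thing as such a module over the opposite C⋆-algebra.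
-/

/-- An adjointable operator `H → K` between Hilbert C⋆-modules over `A`: a map `T` for which there
is a map `S : K → H` with `⟨T x, y⟩ = ⟨x, S y⟩` for all `x`, `y`. Linearity and boundedness are
consequences. -/
structure AdjointableOp (A H K : Type*) [Inner A H] [Inner A K] where
  /-- the underlying map -/
  toFun : H → K
  exists_adjoint : ∃ S : K → H, ∀ x y, inner A (toFun x) y = inner A x (S y)

namespace AdjointableOp

section Basic

variable {A H K : Type*} [Inner A H] [Inner A K]

instance : FunLike (AdjointableOp A H K) H K where
  coe := toFun
  coe_injective := by
    rintro ⟨f, hf⟩ ⟨g, hg⟩ h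
    cases h
    rfl

@[ext]
theorem ext {S T : AdjointableOp A H K} (h : ∀ x, S x = T x) : S = T := DFunLike.ext _ _ h

@[simp]
theorem coe_mk (f : H → K) (hf) (x : H) : (⟨f, hf⟩ : AdjointableOp A H K) x = f x := rfl

end Basic

section Module

variable {A H K E F : Type*} [NonUnitalCStarAlgebra A] [PartialOrder A]
  [NormedAddCommGroup H] [NormedSpace ℂ H] [SMul A H] [CStarModule A H]
  [NormedAddCommGroup K] [NormedSpace ℂ K] [SMul A K] [CStarModule A K]
  [NormedAddCommGroup E] [NormedSpace ℂ E] [SMul A E] [CStarModule A E]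
  [NormedAddCommGroup F] [NormedSpace ℂ F] [SMul A F] [CStarModule A F]

variable (A) in
theorem ext_inner_left {x y : H} (h : ∀ z, inner A z x = inner A z y) : x = y := by
  have h' : inner A (x - y) (x - y) = 0 := by
    rw [CStarModule.inner_sub_right, h, sub_self]
  exact sub_eq_zero.mp (CStarModule.inner_self.mp h')

/-- The adjoint `T*` of an adjointable operator. -/
noncomputable def adjoint (T : AdjointableOp A H K) : AdjointableOp A K H where
  toFun := T.exists_adjoint.choose
  exists_adjoint := ⟨T, fun y x => by
    rw [← CStarModule.star_inner, ← T.exists_adjoint.choose_spec x y, CStarModule.star_inner]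
    rfl⟩

theorem inner_adjoint_right (T : AdjointableOp A H K) (x : H) (y : K) :
    inner A x (T.adjoint y) = inner A (T x) y :=
  (T.exists_adjoint.choose_spec x y).symm

theorem inner_adjoint_left (T : AdjointableOp A H K) (y : K) (x : H) :
    inner A (T.adjoint y) x = inner A y (T x) := by
  rw [← CStarModule.star_inner, inner_adjoint_right, CStarModule.star_inner]

/-- The adjoint is determined by its defining property. -/
theorem eq_adjoint {T : AdjointableOp A H K} {S : AdjointableOp A K H}
    (h : ∀ x y, inner A (T x) y = inner A x (S y)) : S = T.adjoint := by
  ext y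
  refine ext_inner_left A fun x => ?_
  rw [inner_adjoint_right, h]

theorem map_add' (T : AdjointableOp A H K) (x y : H) : T (x + y) = T x + T y := by
  refine ext_inner_left A fun z => ?_
  rw [CStarModule.inner_add_right, ← inner_adjoint_left, ← inner_adjoint_left,
    ← inner_adjoint_left, CStarModule.inner_add_right]

instance : AddMonoidHomClass (AdjointableOp A H K) H K where
  map_add := map_add'
  map_zero T := by simpa using map_add' T 0 0

instance : Zero (AdjointableOp A H K) := ⟨⟨fun _ => 0, ⟨fun _ => 0, fun x y => by simp⟩⟩⟩

instance : Add (AdjointableOp A H K) :=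
  ⟨fun S T => ⟨fun x => S x + T x, ⟨fun y => S.adjoint y + T.adjoint y, fun x y => by
    simp [inner_adjoint_right]⟩⟩⟩

instance : Neg (AdjointableOp A H K) :=
  ⟨fun T => ⟨fun x => -T x, ⟨fun y => -T.adjoint y, fun x y => by simp [inner_adjoint_right]⟩⟩⟩

@[simp] theorem zero_apply (x : H) : (0 : AdjointableOp A H K) x = 0 := rfl
@[simp] theorem add_apply (S T : AdjointableOp A H K) (x : H) : (S + T) x = S x + T x := rfl
@[simp] theorem neg_apply (T : AdjointableOp A H K) (x : H) : (-T) x = -T x := rfl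

instance : AddCommGroup (AdjointableOp A H K) where
  add_assoc _ _ _ := by ext; simp [add_assoc]
  zero_add _ := by ext; simp
  add_zero _ := by ext; simp
  add_comm _ _ := by ext; simp [add_comm]
  neg_add_cancel _ := by ext; simp
  nsmul := nsmulRec
  zsmul := zsmulRec

@[simp] theorem sub_apply (S T : AdjointableOp A H K) (x : H) : (S - T) x = S x - T x := by
  rw [sub_eq_add_neg, sub_eq_add_neg]
  rfl

/-- Composition `S T` of adjointable operators. -/
def comp (S : AdjointableOp A K E) (T : AdjointableOp A H K) : AdjointableOp A H E where
  toFun x := S (T x)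
  exists_adjoint := ⟨fun y => T.adjoint (S.adjoint y), fun x y => by
    simp [inner_adjoint_right]⟩

@[simp] theorem comp_apply (S : AdjointableOp A K E) (T : AdjointableOp A H K) (x : H) :
    S.comp T x = S (T x) := rfl

theorem comp_assoc (R : AdjointableOp A E F) (S : AdjointableOp A K E) (T : AdjointableOp A H K) :
    (R.comp S).comp T = R.comp (S.comp T) := rfl

/-- The identity operator `I_H`. -/
instance : One (AdjointableOp A H H) := ⟨⟨fun x => x, ⟨fun x => x, fun _ _ => rfl⟩⟩⟩

/-- Multiplication in `𝓛(H)` is composition. -/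
instance : Mul (AdjointableOp A H H) := ⟨comp⟩

@[simp] theorem one_apply (x : H) : (1 : AdjointableOp A H H) x = x := rfl
@[simp] theorem mul_apply (S T : AdjointableOp A H H) (x : H) : (S * T) x = S (T x) := rfl

/-- The ring `𝓛(H)` of adjointable operators on `H`. -/
instance : Ring (AdjointableOp A H H) where
  left_distrib _ _ _ := by ext; simp
  right_distrib _ _ _ := by ext; simp
  zero_mul _ := by ext; simp
  mul_zero _ := by ext; simp
  mul_assoc _ _ _ := rfl
  one_mul _ := rfl
  mul_one _ := rfl
  zsmul := zsmulRec
  neg_add_cancel := neg_add_cancel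

theorem adjoint_comp (S : AdjointableOp A K E) (T : AdjointableOp A H K) :
    (S.comp T).adjoint = T.adjoint.comp S.adjoint :=
  (eq_adjoint fun x y => by simp [inner_adjoint_right]).symm

/-- A weight on `K`: a self-adjoint operator that is invertible in `𝓛(K)`. -/
structure IsWeight (M : AdjointableOp A K K) : Prop where
  selfAdjoint : M.adjoint = M
  invertible : IsUnit M

/-- `X` is a weighted Moore–Penrose inverse of `T` with respect to `M` and `N`:
`TXT = T`, `XTX = X`, `(MTX)* = MTX`, `(NXT)* = NXT`. -/
structure IsWeightedMPInverse (M : AdjointableOp A K K) (N : AdjointableOp A H H)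
    (T : AdjointableOp A H K) (X : AdjointableOp A K H) : Prop where
  comp_self_left : (T.comp X).comp T = T
  comp_self_right : (X.comp T).comp X = X
  left_selfAdjoint : (M * T.comp X).adjoint = M * T.comp X
  right_selfAdjoint : (N * X.comp T).adjoint = N * X.comp T

/-- If `MP`, `MQ` and `MPQ` are self-adjoint for a weight `M`, then `P` and `Q` commute. -/
theorem IsWeight.commute {M P Q : AdjointableOp A K K} (hM : IsWeight M)
    (hP : (M * P).adjoint = M * P) (hQ : (M * Q).adjoint = M * Q)
    (hPQ : (M * (P * Q)).adjoint = M * (P * Q)) : P * Q = Q * P := by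
  have hP' : P.adjoint * M = M * P := by
    rw [← hP]; conv_lhs => rw [← hM.selfAdjoint]
    exact (adjoint_comp M P).symm
  have hQ' : Q.adjoint * M = M * Q := by
    rw [← hQ]; conv_lhs => rw [← hM.selfAdjoint]
    exact (adjoint_comp M Q).symm
  refine hM.invertible.mul_left_cancel ?_
  calc M * (P * Q) = (M * (P * Q)).adjoint := hPQ.symm
    _ = (M * P * Q).adjoint := by rw [mul_assoc]
    _ = Q.adjoint * (M * P).adjoint := adjoint_comp (M * P) Q
    _ = M * (Q * P) := by rw [hP, ← mul_assoc, hQ', mul_assoc]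

/-- For weights `M` and `N` the weighted Moore–Penrose inverse is unique if it exists. -/
theorem IsWeightedMPInverse.unique {M : AdjointableOp A K K} {N : AdjointableOp A H H}
    (hM : IsWeight M) (hN : IsWeight N) {T : AdjointableOp A H K} {X Y : AdjointableOp A K H}
    (hX : IsWeightedMPInverse M N T X) (hY : IsWeightedMPInverse M N T Y) : X = Y := by
  have a1 : T.comp X * T.comp Y = T.comp Y := congrArg (fun S => comp S Y) hX.comp_self_left
  have a2 : T.comp Y * T.comp X = T.comp X := congrArg (fun S => comp S X) hY.comp_self_left
  have b1 : X.comp T * Y.comp T = X.comp T := congrArg (fun S => comp X S) hY.comp_self_left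
  have b2 : Y.comp T * X.comp T = Y.comp T := congrArg (fun S => comp Y S) hX.comp_self_left
  have h1 : T.comp X = T.comp Y := by
    have h := hM.commute hX.left_selfAdjoint hY.left_selfAdjoint
      (by rw [a1]; exact hY.left_selfAdjoint)
    rw [a1, a2] at h
    exact h.symm
  have h2 : X.comp T = Y.comp T := by
    have h := hN.commute hX.right_selfAdjoint hY.right_selfAdjoint
      (by rw [b1]; exact hX.right_selfAdjoint)
    rwa [b1, b2] at h
  rw [← hX.comp_self_right, h2, comp_assoc, h1, ← comp_assoc, hY.comp_self_right]

/-- The weighted Moore–Penrose inverse `T†_{MN}` exists (in `𝓛(K, H)`). -/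
def WeightedMPInvertible (M : AdjointableOp A K K) (N : AdjointableOp A H H)
    (T : AdjointableOp A H K) : Prop :=
  ∃ X, IsWeightedMPInverse M N T X

open scoped Classical in
/-- The weighted Moore–Penrose inverse `T†_{MN}`; only meaningful if it exists. -/
noncomputable def weightedMPInverse (M : AdjointableOp A K K) (N : AdjointableOp A H H)
    (T : AdjointableOp A H K) : AdjointableOp A K H :=
  if h : WeightedMPInvertible M N T then h.choose else 0

/-- The Moore–Penrose inverse `T†` exists. -/
def MPInvertible (T : AdjointableOp A H K) : Prop := WeightedMPInvertible 1 1 T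

/-- The Moore–Penrose inverse `T† = T†_{II}`; only meaningful if it exists. -/
noncomputable def mpInverse (T : AdjointableOp A H K) : AdjointableOp A K H :=
  weightedMPInverse 1 1 T

/-- `R_{T,X} = T†T + (I - T†T)X`, for `T` with a Moore–Penrose inverse. -/
noncomputable def opR (T : AdjointableOp A H K) (X : AdjointableOp A H H) : AdjointableOp A H H :=
  T.mpInverse.comp T + (1 - T.mpInverse.comp T) * X

/-- `L_{T,Y} = TT† + Y(I - TT†)`, for `T` with a Moore–Penrose inverse. -/
noncomputable def opL (T : AdjointableOp A H K) (Y : AdjointableOp A K K) : AdjointableOp A K K :=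
  T.comp T.mpInverse + Y * (1 - T.comp T.mpInverse)

end Module

end AdjointableOp

/-! A weighted inverse X amounts to two idempotents: Q = AX with the range of A and MQ self-adjoint,
and E = XA with the kernel of A and NE self-adjoint. Conversely, any inner inverse D of A with such
Q and E gives X = EDQ (`isWeightedMPInverse_of_idempotents`). The M- and N-conditions thus decouple,
so (i) and (ii) agree once (i) yields A†.

For A†, Q and E must be replaced by projections. As Q - Q* is skew-adjoint, 1 + Q - Q* is
invertible, and Q(1 + Q - Q*)⁻¹ is a projection with the range of Q.

For (iii), let P = AA†. Self-adjointness of MQ forces ker Q = M⁻¹ ran(1 - P). Now L = P + M⁻¹(1 - P)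
fixes ran P and maps ran(1 - P) onto that space, so L is invertible exactly when Q exists, and Q =
PL⁻¹. Taking adjoints gives E = R⁻¹A†A in the same way, and EA†Q = R⁻¹A†L⁻¹. -/

/-! ### Idempotents and projections in a star ring -/

section StarRing

variable {R : Type*} [Ring R] [StarRing R]

/-- If `1 + q - q*` is invertible for an idempotent `q`, then there is a projection with the same
range as `q`. -/
theorem exists_projection_of_isUnit {q : R} (hq : q * q = q) (hu : IsUnit (1 + (q - star q))) :
    ∃ p : R, star p = p ∧ p * q = q ∧ q * p = p := by
  obtain ⟨u, hu⟩ := hu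
  have hq' : star q * star q = star q := by rw [← star_mul, hq]
  have h1 : star (u : R) * q = star q * q := by
    rw [hu]; simp only [star_add, star_sub, star_star, star_one, add_mul, sub_mul, hq]; simp
  have h2 : star q * (u : R) = star q * q := by
    rw [hu]; simp only [mul_add, mul_sub, hq']; simp
  have hv : (u : R) * ↑u⁻¹ = 1 := u.mul_inv
  have hv' : star (↑u⁻¹ : R) * star (u : R) = 1 := by rw [← star_mul, hv, star_one]
  -- By `h1`, q u⁻¹ is the conjugate u⁻* (q* q) u⁻¹ of a self-adjoint element.
  have hp : star (q * ↑u⁻¹) = q * ↑u⁻¹ := by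
    calc star (q * (↑u⁻¹ : R)) = star (↑u⁻¹ : R) * (star q * (u : R)) * ↑u⁻¹ := by
          rw [star_mul, mul_assoc, mul_assoc (star q), hv, mul_one]
      _ = q * ↑u⁻¹ := by rw [h2, ← h1, ← mul_assoc, hv', one_mul]
  refine ⟨q * ↑u⁻¹, hp, ?_, by rw [← mul_assoc, hq]⟩
  rw [← hp, star_mul, mul_assoc, ← h1, ← mul_assoc, hv', one_mul]

/-- `q` is an idempotent with the same range as the projection `p`, and `m q` is self-adjoint. -/
structure IsWeightedRangeIdempotent (m p q : R) : Prop where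
  mul_left : p * q = q
  mul_right : q * p = p
  star_eq : star (m * q) = m * q

/-- The inverse acts separately on the two summands of q: as the identity on ran q = ran p, and as m
on ker q, which m carries into ran(1 - p). -/
theorem IsWeightedRangeIdempotent.isUnit {m w p q : R} (hm : star m = m)
    (hmw : m * w = 1) (hwm : w * m = 1) (hp : star p = p) (h : IsWeightedRangeIdempotent m p q) :
    IsUnit (p + w * (1 - p)) := by
  obtain ⟨hpq, hqp, hs⟩ := h
  have hqm : star q * m = m * q := by rw [← hs, star_mul, hm]
  have hpp : p * p = p := by
    calc p * p = p * q * p := by rw [mul_assoc, hqp]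
      _ = p := by rw [hpq, hqp]
  have hpq' : p * star q = p := by
    have := congrArg star hqp; rwa [star_mul, hp] at this
  have hqp' : star q * p = star q := by
    have := congrArg star hpq; rwa [star_mul, hp] at this
  have h1 : p * m * q = p * m := by rw [mul_assoc, ← hqm, ← mul_assoc, hpq']
  have h2 : q * w = w * star q := by
    calc q * w = w * (m * q) * w := by rw [← mul_assoc, hwm, one_mul]
      _ = w * star q := by rw [← hqm, mul_assoc, mul_assoc, hmw, mul_one]
  have h3 : (p + w * (1 - p)) * (q + (1 - p) * m * (1 - q)) = 1 := by
    have h4 : (1 - p) * ((1 - p) * m * (1 - q)) = m * (1 - q) := by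
      simp only [mul_sub, sub_mul, mul_one, one_mul, ← mul_assoc, hpp, h1]; abel
    have h5 : p * ((1 - p) * m * (1 - q)) = 0 := by
      simp only [mul_sub, sub_mul, mul_one, one_mul, ← mul_assoc, hpp]; abel
    have h6 : (1 - p) * q = 0 := by rw [sub_mul, one_mul, hpq, sub_self]
    rw [add_mul, mul_add, mul_add, hpq, h5, mul_assoc w, mul_assoc w, h6, h4, ← mul_assoc, hwm]
    simp
  have h7 : (q + (1 - p) * m * (1 - q)) * (p + w * (1 - p)) = 1 := by
    have h8 : q * (w * (1 - p)) = 0 := by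
      rw [← mul_assoc, h2, mul_assoc, mul_sub, mul_one, hqp', sub_self, mul_zero]
    have h9 : (1 - q) * p = 0 := by rw [sub_mul, one_mul, hqp, sub_self]
    have h10 : (1 - q) * (w * (1 - p)) = w * (1 - p) := by rw [sub_mul, one_mul, h8, sub_zero]
    rw [add_mul, mul_add, mul_add, hqp, h8, mul_assoc, mul_assoc, mul_assoc, mul_assoc, h9, h10,
      ← mul_assoc m, hmw]
    simp [mul_sub, sub_mul, hpp]
  exact ⟨⟨_, _, h3, h7⟩, rfl⟩

/-- With l = p + w(1 - p), l fixes ran p, so p l⁻¹ keeps the range of p. Moreover p m l = p m p = l*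
m p, which makes m p l⁻¹ = l⁻* (p m p) l⁻¹ self-adjoint. -/
theorem isWeightedRangeIdempotent_of_isUnit {m w p : R} (hm : star m = m) (hw : star w = w)
    (hmw : m * w = 1) (hwm : w * m = 1) (hp : star p = p) (hpp : p * p = p)
    (hu : IsUnit (p + w * (1 - p))) :
    IsWeightedRangeIdempotent m p (p * Ring.inverse (p + w * (1 - p))) := by
  set l := p + w * (1 - p) with hl
  have hlv : l * Ring.inverse l = 1 := Ring.mul_inverse_cancel _ hu
  have hvl : Ring.inverse l * l = 1 := Ring.inverse_mul_cancel _ hu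
  have hlp : l * p = p := by
    rw [hl, add_mul, mul_assoc, sub_mul, one_mul, hpp, sub_self, mul_zero, add_zero]
  have hvp : Ring.inverse l * p = p := by
    conv_lhs => rw [← hlp]
    rw [← mul_assoc, hvl, one_mul]
  refine ⟨by rw [← mul_assoc, hpp], by rw [mul_assoc, hvp, hpp], ?_⟩
  have hls : star (Ring.inverse l) * star l = 1 := by rw [← star_mul, hlv, star_one]
  have h1 : p * m * l = p * m * p := by
    rw [hl, mul_add, ← mul_assoc, mul_assoc p m w, hmw, mul_one, mul_sub, hpp]; simp
  have h2 : star l * m * p = p * m * p := by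
    rw [hl, star_add, star_mul, star_sub, star_one, hp, hw, add_mul, mul_assoc (1 - p), hwm,
      add_mul, mul_one, sub_mul, hpp]; simp
  calc star (m * (p * Ring.inverse l))
      = star (Ring.inverse l) * (p * m * l) * Ring.inverse l := by
        rw [star_mul, star_mul, hm, hp, mul_assoc _ (p * m * l), mul_assoc (p * m), hlv]
        simp only [mul_one, mul_assoc]
    _ = star (Ring.inverse l) * star l * m * p * Ring.inverse l := by
        rw [h1, ← h2]; simp only [mul_assoc]
    _ = m * (p * Ring.inverse l) := by rw [hls, one_mul, mul_assoc]

/-- Since e* m = m e, w e* equals w (m e) w. This turns the N-condition on a kernel idempotent E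
into the N⁻¹-condition on the range idempotent E*. -/
theorem star_mul_star_eq_of_star_mul_eq {m w e : R} (hm : star m = m) (hw : star w = w)
    (hmw : m * w = 1) (hwm : w * m = 1) (h : star (m * e) = m * e) :
    star (w * star e) = w * star e := by
  have h' : star e * m = m * e := by rw [← h, star_mul, hm]
  calc star (w * star e) = w * (m * e) * w := by
        rw [star_mul, star_star, hw, ← mul_assoc, hwm, one_mul]
    _ = w * star e := by rw [← h', mul_assoc, mul_assoc, hmw, mul_one]

end StarRing

/-! ### The method of continuity -/

section CompleteNormedSpace

variable {E : Type*} [NormedAddCommGroup E] [NormedSpace ℂ E] [CompleteSpace E]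

/-- The method of continuity: if all `1 + s T` with `s ≥ 0` do not decrease norms, then `1 + T` is
invertible. -/
theorem ContinuousLinearMap.isUnit_one_add_of_norm_le (T : E →L[ℂ] E)
    (hT : ∀ s : ℝ, ∀ x, ‖x‖ ≤ ‖x + (s : ℂ) • T x‖) : IsUnit (1 + T) := by
  rcases subsingleton_or_nontrivial E with hE | hE
  · exact ⟨1, by ext x; exact Subsingleton.elim _ _⟩
  obtain ⟨n, hn⟩ := exists_nat_gt ‖T‖
  have hn0 : (0 : ℝ) < n := (norm_nonneg _).trans_lt hn
  -- Steps of size 1/n move the operator by ‖T‖/n < 1, while the lower bound `hT` keeps the inverse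
  -- at norm at most 1, so every step stays among the units.
  have hstep : ∀ k : ℕ, IsUnit (1 + ((k / n : ℝ) : ℂ) • T) := by
    intro k
    induction k with
    | zero => simp
    | succ k ih =>
      obtain ⟨u, hu⟩ := ih
      have hinv : ‖(↑u⁻¹ : E →L[ℂ] E)‖ ≤ 1 := by
        refine ContinuousLinearMap.opNorm_le_bound _ zero_le_one fun y => ?_
        have h := hT (k / n) ((↑u⁻¹ : E →L[ℂ] E) y)
        have h' : (u : E →L[ℂ] E) ((↑u⁻¹ : E →L[ℂ] E) y) = y := by
          rw [← mul_apply_eq_comp, u.mul_inv, one_apply_eq_self]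
        rw [hu] at h'
        rw [one_mul]
        refine h.trans (le_of_eq (congrArg norm ?_))
        simpa using h'
      have hpos : 0 < ‖(↑u⁻¹ : E →L[ℂ] E)‖ := Units.norm_pos u⁻¹
      refine (u.ofNearby _ (lt_of_lt_of_le ?_ ((one_le_inv₀ hpos).2 hinv))).isUnit
      have hd : (1 + (((k + 1 : ℕ) / n : ℝ) : ℂ) • T) - (u : E →L[ℂ] E)
          = ((1 / n : ℝ) : ℂ) • T := by
        rw [hu, add_sub_add_left_eq_sub, ← sub_smul]
        congr 1
        push_cast
        ring
      rw [hd, norm_smul, Complex.norm_real, Real.norm_of_nonneg (by positivity), one_div,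
        inv_mul_lt_iff₀ hn0, mul_one]
      exact hn
  have := hstep n
  rwa [div_self hn0.ne', Complex.ofReal_one, one_smul] at this

end CompleteNormedSpace

namespace AdjointableOp

/-! ### Skew-adjoint operators on Hilbert modules -/

section Operators

variable {A H K : Type*} [NonUnitalCStarAlgebra A] [PartialOrder A]
  [NormedAddCommGroup H] [NormedSpace ℂ H] [SMul A H] [CStarModule A H]
  [NormedAddCommGroup K] [NormedSpace ℂ K] [SMul A K] [CStarModule A K]

theorem map_smul' (T : AdjointableOp A H K) (c : ℂ) (x : H) : T (c • x) = c • T x := by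
  refine ext_inner_left A fun z => ?_
  rw [CStarModule.inner_smul_right_complex, ← inner_adjoint_left, ← inner_adjoint_left,
    CStarModule.inner_smul_right_complex]

theorem adjoint_adjoint (T : AdjointableOp A H K) : T.adjoint.adjoint = T :=
  (eq_adjoint fun x y => inner_adjoint_left T x y).symm

theorem adjoint_add (S T : AdjointableOp A H K) : (S + T).adjoint = S.adjoint + T.adjoint :=
  (eq_adjoint fun x y => by simp [inner_adjoint_right]).symm

noncomputable instance : StarRing (AdjointableOp A H H) where
  star := adjoint
  star_involutive := adjoint_adjoint
  star_mul := adjoint_comp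
  star_add := adjoint_add

theorem star_eq_adjoint (T : AdjointableOp A H H) : star T = T.adjoint := rfl

/-- The set-theoretic inverse of T* is an adjoint for that of T. -/
theorem isUnit_of_bijective {T : AdjointableOp A H H} (hT : Function.Bijective T)
    (hT' : Function.Bijective T.adjoint) : IsUnit T := by
  obtain ⟨S, hST, hTS⟩ := Function.bijective_iff_has_inverse.1 hT
  obtain ⟨S', -, hTS'⟩ := Function.bijective_iff_has_inverse.1 hT'
  refine ⟨⟨T, ⟨S, S', fun x y => ?_⟩, ext hTS, ext hST⟩, rfl⟩
  conv_lhs => rw [← hTS' y]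
  rw [inner_adjoint_right, hTS]

variable [StarOrderedRing A]

variable (A) in
theorem continuous_inner_right (z : H) : Continuous fun x : H => inner A z x :=
  CStarModule.continuous_inner.comp (Continuous.prodMk_right z)

/-- Skewness cancels the cross terms, leaving ⟨x, x⟩ plus the positive element ⟨sTx, sTx⟩. -/
theorem norm_le_norm_add_smul {T : AdjointableOp A H H} (hT : T.adjoint = -T) (s : ℝ) (x : H) :
    ‖x‖ ≤ ‖x + (s : ℂ) • T x‖ := by
  have hskew : inner A (T x) x = -inner A x (T x) := by
    rw [← inner_adjoint_right, hT, neg_apply, CStarModule.inner_neg_right]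
  have h : inner A (x + (s : ℂ) • T x) (x + (s : ℂ) • T x)
      = inner A x x + inner A ((s : ℂ) • T x) ((s : ℂ) • T x) := by
    rw [CStarModule.inner_add_left, CStarModule.inner_add_right, CStarModule.inner_add_right,
      CStarModule.inner_smul_right_complex, CStarModule.inner_smul_left_complex (y := x), hskew]
    simp
  refine le_of_sq_le_sq ?_ (norm_nonneg _)
  rw [CStarModule.norm_sq_eq A, CStarModule.norm_sq_eq A, h]
  exact CStarAlgebra.norm_le_norm_of_nonneg_of_le CStarModule.inner_self_nonneg
    (le_add_of_nonneg_right CStarModule.inner_self_nonneg)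

variable [CompleteSpace H] [CompleteSpace K]

/-- An adjointable operator is bounded, by the closed graph theorem. -/
noncomputable def toCLM (T : AdjointableOp A H K) : H →L[ℂ] K :=
  ContinuousLinearMap.ofSeqClosedGraph
    (g := { toFun := T, map_add' := map_add' T, map_smul' := map_smul' T })
    fun u x y hu hTu => ext_inner_left A fun z => by
      have h1 := ((continuous_inner_right A z).tendsto y).comp hTu
      have h2 := ((continuous_inner_right A (T.adjoint z)).tendsto x).comp hu
      rw [inner_adjoint_left] at h2
      refine tendsto_nhds_unique h1 (h2.congr fun n => ?_)
      exact inner_adjoint_left T z (u n)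

theorem bijective_one_add {T : AdjointableOp A H H} (hT : T.adjoint = -T) :
    Function.Bijective (1 + T : AdjointableOp A H H) := by
  have h := (ContinuousLinearMap.isUnit_one_add_of_norm_le T.toCLM
    fun s x => norm_le_norm_add_smul hT s x)
  obtain ⟨u, hu⟩ := h
  have hx (x : H) : (u : H →L[ℂ] H) x = (1 + T : AdjointableOp A H H) x := by rw [hu]; rfl
  refine Function.bijective_iff_has_inverse.2 ⟨(↑u⁻¹ : H →L[ℂ] H), fun x => ?_, fun x => ?_⟩
  · rw [← hx, ← mul_apply_eq_comp, u.inv_mul, one_apply_eq_self]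
  · rw [← hx, ← mul_apply_eq_comp, u.mul_inv, one_apply_eq_self]

theorem isUnit_one_add {T : AdjointableOp A H H} (hT : star T = -T) : IsUnit (1 + T) := by
  refine isUnit_of_bijective (bijective_one_add hT) ?_
  have h : (1 + T).adjoint = 1 + -T := by
    rw [← star_eq_adjoint, star_add, star_one, hT]
  rw [h]
  refine bijective_one_add ?_
  rw [← star_eq_adjoint, star_neg, hT]

theorem exists_projection {Q : AdjointableOp A H H} (hQ : Q * Q = Q) :
    ∃ P, star P = P ∧ P * Q = Q ∧ Q * P = P :=
  exists_projection_of_isUnit hQ (isUnit_one_add (by rw [star_sub, star_star, neg_sub]))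

end Operators

/-! ### Weighted inverses, R and L -/

section WeightedInverse

variable {A H K : Type*} [NonUnitalCStarAlgebra A] [PartialOrder A]
  [NormedAddCommGroup H] [NormedSpace ℂ H] [SMul A H] [CStarModule A H]
  [NormedAddCommGroup K] [NormedSpace ℂ K] [SMul A K] [CStarModule A K]
  {M : AdjointableOp A K K} {N : AdjointableOp A H H} {T : AdjointableOp A H K}

/-- A weighted Moore–Penrose inverse from an inner inverse `D`, an idempotent `Q` with the range
of `T` and an idempotent `E` with the kernel of `T`. -/
theorem isWeightedMPInverse_of_idempotents {D : AdjointableOp A K H}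
    {Q : AdjointableOp A K K} {E : AdjointableOp A H H} (hD : (T.comp D).comp T = T)
    (hQ : T.comp D * Q = Q) (hQ' : Q * T.comp D = T.comp D) (hMQ : star (M * Q) = M * Q)
    (hE : E * D.comp T = E) (hE' : D.comp T * E = D.comp T) (hNE : star (N * E) = N * E) :
    IsWeightedMPInverse M N T ((E.comp D).comp Q) := by
  have hTE : T.comp E = T := by
    calc T.comp E = T.comp (D.comp T * E) := by conv_lhs => rw [← hD]
                                                rfl
      _ = T := by rw [hE']; exact hD
  have hQT : Q.comp T = T := by
    calc Q.comp T = (Q * T.comp D).comp T := by conv_lhs => rw [← hD]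
                                                rfl
      _ = T := by rw [hQ']; exact hD
  have h1 : T.comp ((E.comp D).comp Q) = Q := by
    calc T.comp ((E.comp D).comp Q) = ((T.comp E).comp D).comp Q := rfl
      _ = Q := by rw [hTE]; exact hQ
  have h2 : ((E.comp D).comp Q).comp T = E := by
    calc ((E.comp D).comp Q).comp T = (E.comp D).comp (Q.comp T) := rfl
      _ = E := by rw [hQT]; exact hE
  have hEE : E * E = E := by
    calc E * E = E * D.comp T * E := by rw [hE]
      _ = E := by rw [mul_assoc, hE', hE]
  refine ⟨by rw [h1, hQT], ?_, by rw [h1]; exact hMQ, by rw [h2]; exact hNE⟩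
  rw [h2]
  exact congrArg (fun S => (comp S D).comp Q) hEE

theorem IsWeightedMPInverse.left_mul {X Y : AdjointableOp A K H}
    (hX : IsWeightedMPInverse M N T X) : T.comp X * T.comp Y = T.comp Y :=
  congrArg (fun S => comp S Y) hX.comp_self_left

theorem IsWeightedMPInverse.right_mul {X Y : AdjointableOp A K H}
    (hY : IsWeightedMPInverse M N T Y) : X.comp T * Y.comp T = X.comp T :=
  congrArg (fun S => comp X S) hY.comp_self_left

/-- The inverse is in effect ZTY: T(ZTY) = TY inherits the M-condition and (ZTY)T = ZT the
N-condition. -/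
theorem IsWeightedMPInverse.combine {M' : AdjointableOp A K K} {N' : AdjointableOp A H H}
    {Y Z : AdjointableOp A K H} (hY : IsWeightedMPInverse M N' T Y)
    (hZ : IsWeightedMPInverse M' N T Z) : WeightedMPInvertible M N T :=
  ⟨_, isWeightedMPInverse_of_idempotents hY.comp_self_left hY.left_mul
    hY.left_mul hY.left_selfAdjoint hY.right_mul hZ.right_mul
    hZ.right_selfAdjoint⟩

theorem IsWeightedMPInverse.mpInvertible [StarOrderedRing A] [CompleteSpace H] [CompleteSpace K]
    {X : AdjointableOp A K H} (hX : IsWeightedMPInverse M N T X) : MPInvertible T := by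
  obtain ⟨P, hP, hPQ, hQP⟩ := exists_projection hX.left_mul
  -- A projection with the range of (XT)* has the kernel of XT, which is that of T.
  obtain ⟨F, hF, hFE, hEF⟩ := exists_projection (Q := star (X.comp T)) (by
    rw [← star_mul, hX.right_mul])
  refine ⟨_, isWeightedMPInverse_of_idempotents (E := F) hX.comp_self_left hQP hPQ ?_ ?_ ?_ ?_⟩
  · rw [one_mul, hP]
  · simpa [hF] using congrArg star hEF
  · simpa [hF] using congrArg star hFE
  · rw [one_mul, hF]

theorem WeightedMPInvertible.isWeightedMPInverse (h : WeightedMPInvertible M N T) :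
    IsWeightedMPInverse M N T (weightedMPInverse M N T) := by
  have : weightedMPInverse M N T = Exists.choose h := dif_pos h
  rw [this]
  exact Exists.choose_spec h

theorem MPInvertible.isWeightedMPInverse (h : MPInvertible T) :
    IsWeightedMPInverse 1 1 T T.mpInverse :=
  WeightedMPInvertible.isWeightedMPInverse h

theorem IsWeight.star_inverse (hM : IsWeight M) : star (Ring.inverse M) = Ring.inverse M := by
  rw [← Ring.inverse_star, star_eq_adjoint, hM.selfAdjoint]

/-- R* has the shape of L, with T†T for TT† and N for M⁻¹, so the weight governing the right-hand
side is N⁻¹. -/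
theorem star_opR (hN : IsWeight N) (hT : MPInvertible T) :
    star (T.opR N) = T.mpInverse.comp T + N * (1 - T.mpInverse.comp T) := by
  have hF : star (T.mpInverse.comp T) = T.mpInverse.comp T := by
    simpa using! hT.isWeightedMPInverse.right_selfAdjoint
  have hN' : star N = N := hN.selfAdjoint
  rw [opR, star_add, star_mul, star_sub, star_one, hF, hN']

theorem isUnit_opL (hM : IsWeight M) (hT : MPInvertible T) {X : AdjointableOp A K H}
    (hX : IsWeightedMPInverse M N T X) : IsUnit (T.opL (Ring.inverse M)) := by
  have hD := hT.isWeightedMPInverse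
  exact IsWeightedRangeIdempotent.isUnit hM.selfAdjoint
    (Ring.mul_inverse_cancel _ hM.invertible) (Ring.inverse_mul_cancel _ hM.invertible)
    (by simpa using! hD.left_selfAdjoint)
    ⟨hD.left_mul, hX.left_mul, hX.left_selfAdjoint⟩

theorem isUnit_opR (hN : IsWeight N) (hT : MPInvertible T) {X : AdjointableOp A K H}
    (hX : IsWeightedMPInverse M N T X) : IsUnit (T.opR N) := by
  have hD := hT.isWeightedMPInverse
  have hF : star (T.mpInverse.comp T) = T.mpInverse.comp T := by
    simpa using! hD.right_selfAdjoint
  have h1 := Ring.mul_inverse_cancel _ hN.invertible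
  have h2 := Ring.inverse_mul_cancel _ hN.invertible
  rw [← isUnit_star, star_opR hN hT]
  refine IsWeightedRangeIdempotent.isUnit (q := star (X.comp T)) hN.star_inverse
    h2 h1 hF ⟨?_, ?_, ?_⟩
  · simpa [hF] using congrArg star (hD.right_mul (X := X))
  · simpa [hF] using congrArg star (hX.right_mul (X := T.mpInverse))
  · exact star_mul_star_eq_of_star_mul_eq hN.selfAdjoint hN.star_inverse h1 h2
      hX.right_selfAdjoint

theorem isWeightedMPInverse_of_isUnit (hM : IsWeight M) (hN : IsWeight N) (hT : MPInvertible T)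
    (hR : IsUnit (T.opR N)) (hL : IsUnit (T.opL (Ring.inverse M))) :
    IsWeightedMPInverse M N T
      (((Ring.inverse (T.opR N)).comp T.mpInverse).comp
        (Ring.inverse (T.opL (Ring.inverse M)))) := by
  have hD := hT.isWeightedMPInverse
  have hP : star (T.comp T.mpInverse) = T.comp T.mpInverse := by
    simpa using! hD.left_selfAdjoint
  have hF : star (T.mpInverse.comp T) = T.mpInverse.comp T := by
    simpa using! hD.right_selfAdjoint
  have hM1 := Ring.mul_inverse_cancel _ hM.invertible
  have hM2 := Ring.inverse_mul_cancel _ hM.invertible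
  have hN1 := Ring.mul_inverse_cancel _ hN.invertible
  have hN2 := Ring.inverse_mul_cancel _ hN.invertible
  have hQ : IsWeightedRangeIdempotent M (T.comp T.mpInverse)
      (T.comp T.mpInverse * Ring.inverse (T.opL (Ring.inverse M))) :=
    isWeightedRangeIdempotent_of_isUnit hM.selfAdjoint hM.star_inverse hM1 hM2 hP
      hD.left_mul hL
  have hE : IsWeightedRangeIdempotent (Ring.inverse N) (T.mpInverse.comp T)
      (T.mpInverse.comp T * Ring.inverse (star (T.opR N))) := by
    have hR' := hR.star
    rw [star_opR hN hT] at hR' ⊢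
    exact isWeightedRangeIdempotent_of_isUnit hN.star_inverse hN.selfAdjoint hN2 hN1 hF
      hD.right_mul hR'
  have hs : star (T.mpInverse.comp T * Ring.inverse (star (T.opR N)))
      = Ring.inverse (T.opR N) * T.mpInverse.comp T := by
    rw [star_mul, hF, Ring.inverse_star, star_star]
  have h1 := congrArg star hE.mul_left
  have h2 := congrArg star hE.mul_right
  have h3 := star_mul_star_eq_of_star_mul_eq hN.star_inverse hN.selfAdjoint hN2 hN1 hE.star_eq
  rw [star_mul, hs, hF] at h1
  rw [star_mul, hs, hF] at h2
  rw [hs] at h3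
  have h := isWeightedMPInverse_of_idempotents hD.comp_self_left hQ.mul_left hQ.mul_right
    hQ.star_eq h1 h2 h3
  -- The product E T† Q contains T†T T† TT†, which collapses to T†.
  have hDD : (T.mpInverse.comp T).comp (T.mpInverse.comp (T.comp T.mpInverse)) = T.mpInverse := by
    calc (T.mpInverse.comp T).comp (T.mpInverse.comp (T.comp T.mpInverse))
        = ((((T.mpInverse.comp T).comp T.mpInverse).comp T).comp T.mpInverse) := rfl
      _ = T.mpInverse := by rw [hD.comp_self_right, hD.comp_self_right]
  have he := congrArg (fun S => ((Ring.inverse (T.opR N)).comp S).comp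
    (Ring.inverse (T.opL (Ring.inverse M)))) hDD
  exact he ▸ h

end WeightedInverse

end AdjointableOp

/-! ### The equivalence and the formula -/

theorem mainTheorem1 {𝔄 H K : Type*}
    [NonUnitalCStarAlgebra 𝔄] [PartialOrder 𝔄] [StarOrderedRing 𝔄]
    [NormedAddCommGroup H] [NormedSpace ℂ H] [SMul 𝔄 H] [CStarModule 𝔄 H] [CompleteSpace H]
    [NormedAddCommGroup K] [NormedSpace ℂ K] [SMul 𝔄 K] [CStarModule 𝔄 K] [CompleteSpace K]
    (M : AdjointableOp 𝔄 K K) (N : AdjointableOp 𝔄 H H) (hM : M.IsWeight) (hN : N.IsWeight)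
    (A : AdjointableOp 𝔄 H K) :
    List.TFAE [
      AdjointableOp.WeightedMPInvertible M N A,
      AdjointableOp.WeightedMPInvertible M 1 A ∧ AdjointableOp.WeightedMPInvertible 1 N A,
      A.MPInvertible ∧ IsUnit (A.opR N) ∧ IsUnit (A.opL (Ring.inverse M))] ∧
    (AdjointableOp.WeightedMPInvertible M N A →
      AdjointableOp.weightedMPInverse M N A =
        ((Ring.inverse (A.opR N)).comp A.mpInverse).comp
          (Ring.inverse (A.opL (Ring.inverse M)))) := by
  have h31 : A.MPInvertible ∧ IsUnit (A.opR N) ∧ IsUnit (A.opL (Ring.inverse M)) →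
      AdjointableOp.WeightedMPInvertible M N A := fun ⟨hA, hR, hL⟩ =>
    ⟨_, AdjointableOp.isWeightedMPInverse_of_isUnit hM hN hA hR hL⟩
  have h13 : AdjointableOp.WeightedMPInvertible M N A →
      A.MPInvertible ∧ IsUnit (A.opR N) ∧ IsUnit (A.opL (Ring.inverse M)) := fun ⟨_, hX⟩ =>
    ⟨hX.mpInvertible, AdjointableOp.isUnit_opR hN hX.mpInvertible hX,
      AdjointableOp.isUnit_opL hM hX.mpInvertible hX⟩
  refine ⟨?_, fun h => ?_⟩
  · tfae_have 1 ↔ 3 := ⟨h13, h31⟩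
    tfae_have 1 → 2 := fun ⟨_, hX⟩ =>
      ⟨hX.combine hX.mpInvertible.isWeightedMPInverse,
        hX.mpInvertible.isWeightedMPInverse.combine hX⟩
    tfae_have 2 → 1 := fun ⟨⟨_, hY⟩, ⟨_, hZ⟩⟩ => hY.combine hZ
    tfae_finish
  · obtain ⟨hA, hR, hL⟩ := h13 h
    exact h.isWeightedMPInverse.unique hM hN
      (AdjointableOp.isWeightedMPInverse_of_isUnit hM hN hA hR hL)
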